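/- Let $n\ge 1$ be an integer and let $S_n$ be the group of permutations of $[n]=\{0,1,\dots,n-1\}$, where a permutation $\pi$ is written as the vector $(\pi(0),\pi(1),\dots,\pi(n-1))$ and products are compositions of functions. For $0\le i\le n-1$ and $1\le s\le n-i$ let $\kappa_{i,s}\in S_n$ be the suffix block transposition $$\kappa_{i,s}=(0,1,\dots,i-1,\ i+s,i+s+1,\dots,n-1,\ i,i+1,\dots,i+s-1),$$ so that $\kappa_{i,n-i}$ is the identity. Let $V_n$ be the set of integer vectors $[a_0,a_1,\dots,a_{n-1}]$ with $1\le a_j\le j+1$ for all $j$. The map $$V_n\to S_n,\qquad [a_0,a_1,\dots,a_{n-1}]\mapsto \kappa_{n-2,a_1}\kappa_{n-3,a_2}\cdots\kappa_{1,a_{n-2}}\kappa_{0,a_{n-1}}$$ is a bijection; denote its inverse by $R$. The parity of a permutation $\pi$ is the integer $\mathrm{parity}(\pi)=a_0+a_1+\cdots+a_{n-1}$, where $[a_0,\dots,a_{n-1}]=R(\pi)$. Theorem. Let $\rho\in S_n$ be any permutation, and define $\pi^{(j)}=\kappa_{n-j-1,1}\circ\rho$ for $j=0,1,\dots,n-1$.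 Then the integers $\mathrm{parity}(\pi^{(0)}),\dots,\mathrm{parity}(\pi^{(n-1)})$ are pairwise distinct, and the set $\{\mathrm{parity}(\pi^{(j)}): j=0,1,\dots,n-1\}$ consists of $n$ consecutive integers. Consequently, for every integer $T$ there is exactly one $j\in\{0,1,\dots,n-1\}$ with $\mathrm{parity}(\pi^{(j)})\equiv T\pmod n$. -/

import Mathlib

/-! Permutations of length `n` are elements of `Equiv.Perm (Fin n)`; the vector notation
`(π 0, π 1, …, π (n-1))` lists the values, and `*` is composition of functions. -/

namespace SuffixBlock

/-- The underlying map of the suffix block transposition `κ_{i,s}`: positions `x < i` are fixed,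
and the suffix of positions `i, …, n-1` is rotated cyclically by `s`. -/
def kappaFun {n : ℕ} (i : Fin n) (s : ℕ) (x : Fin n) : Fin n :=
  if x < i then x
  else ⟨i + (x - i + s) % (n - i), by
    have h := Nat.mod_lt ((x : ℕ) - i + s) (show 0 < n - (i : ℕ) by omega)
    omega⟩

theorem kappaFun_injective {n : ℕ} (i : Fin n) (s : ℕ) :
    Function.Injective (kappaFun i s) := by
  intro x y h
  have hi := i.isLt
  have hx := x.isLt
  have hy := y.isLt
  have h1 := congrArg Fin.val h
  unfold kappaFun at h1
  simp only [Fin.lt_def] at h1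
  split_ifs at h1 with hxi hyi hyi
  · exact Fin.ext h1
  · simp only at h1
    omega
  · simp only at h1
    omega
  · simp only at h1
    have h2 : ((x : ℕ) - i + s) ≡ ((y : ℕ) - i + s) [MOD (n - i)] := by
      unfold Nat.ModEq
      omega
    have h3 := Nat.ModEq.add_right_cancel' s h2
    have h4 := Nat.ModEq.eq_of_lt_of_lt h3 (by omega) (by omega)
    exact Fin.ext (by omega)

/-- The suffix block transposition `κ_{i,s}`. For `1 ≤ s ≤ n - i` its vector representation is
`(0, …, i-1, i+s, i+s+1, …, n-1, i, i+1, …, i+s-1)`, see `kappa_of_lt`, `kappa_of_left` and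
`kappa_of_right`; in particular `κ_{i,n-i}` is the identity. -/
noncomputable def kappa {n : ℕ} (i : Fin n) (s : ℕ) : Equiv.Perm (Fin n) :=
  Equiv.ofBijective (kappaFun i s) (Finite.injective_iff_bijective.mp (kappaFun_injective i s))

theorem kappa_of_lt {n : ℕ} (i : Fin n) (s : ℕ) (x : Fin n) (h : x < i) :
    kappa i s x = x := by
  simp [kappa, kappaFun, h]

theorem kappa_of_left {n : ℕ} (i : Fin n) (s : ℕ) (x : Fin n) (h : i ≤ x)
    (hx : (x : ℕ) + s < n) : (kappa i s x : ℕ) = x + s := by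
  have h' : (i : ℕ) ≤ x := h
  simp only [kappa, kappaFun, Equiv.ofBijective_apply, not_lt.mpr h, if_false]
  rw [Nat.mod_eq_of_lt (by omega)]
  omega

theorem kappa_of_right {n : ℕ} (i : Fin n) (s : ℕ) (x : Fin n) (hs : s ≤ n - i)
    (hx : n ≤ (x : ℕ) + s) : (kappa i s x : ℕ) = i + (x - (n - s)) := by
  have h' : (i : ℕ) ≤ x := by omega
  have h : i ≤ x := h'
  have hi := i.isLt
  have hx' := x.isLt
  simp only [kappa, kappaFun, Equiv.ofBijective_apply, not_lt.mpr h, if_false]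
  rw [Nat.mod_eq_sub_mod (by omega), Nat.mod_eq_of_lt (by omega)]
  omega

theorem kappa_eq_one {n : ℕ} (i : Fin n) : kappa i (n - i) = 1 := by
  ext x
  by_cases h : x < i
  · rw [kappa_of_lt _ _ _ h]; rfl
  · have h' : (i : ℕ) ≤ x := not_lt.mp h
    have hi := i.isLt
    rw [kappa_of_right _ _ _ le_rfl (by omega)]
    simp only [Equiv.Perm.coe_one, id_eq]
    omega

/-- `V_n`: the integer vectors `[a_0, …, a_{n-1}]` with `1 ≤ a_j ≤ j + 1`. -/
def V (n : ℕ) : Type := {a : Fin n → ℕ // ∀ j : Fin n, 1 ≤ a j ∧ a j ≤ (j : ℕ) + 1}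

/-- `[a_0, …, a_{n-1}] ↦ κ_{n-1,a_0} κ_{n-2,a_1} ⋯ κ_{1,a_{n-2}} κ_{0,a_{n-1}}`. Here
`Fin.rev j = n - 1 - j`, and the first factor is `κ_{n-1,1}`, the identity. -/
noncomputable def toPerm {n : ℕ} (a : V n) : Equiv.Perm (Fin n) :=
  (List.ofFn fun j : Fin n => kappa (Fin.rev j) (a.1 j)).prod

theorem prod_fix {n : ℕ} (a : Fin n → ℕ) (l : List (Fin n)) (y : Fin n)
    (h : ∀ j ∈ l, y < Fin.rev j) :
    (l.map fun j => kappa (Fin.rev j) (a j)).prod y = y := by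
  induction l with
  | nil => rfl
  | cons b l ih =>
    rw [List.map_cons, List.prod_cons, Equiv.Perm.mul_apply,
      ih fun j hj => h j (List.mem_cons_of_mem _ hj)]
    exact kappa_of_lt _ _ _ (h b List.mem_cons_self)

theorem kappa_pivot {n : ℕ} (i : Fin n) (s : ℕ) (h1 : 1 ≤ s) (h2 : s ≤ n - i) :
    kappa i s ⟨n - s, by have := i.isLt; omega⟩ = i := by
  apply Fin.ext
  rw [kappa_of_right i s _ h2 (by simp only; omega)]
  simp

theorem prod_injective {n : ℕ} (a b : V n) (m : ℕ)
    (h : (((List.finRange n).take m).map fun j => kappa (Fin.rev j) (a.1 j)).prod =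
      (((List.finRange n).take m).map fun j => kappa (Fin.rev j) (b.1 j)).prod) :
    ∀ j : Fin n, (j : ℕ) < m → a.1 j = b.1 j := by
  induction m with
  | zero => intro j hj; omega
  | succ m ih =>
    by_cases hm : m < n
    · have key : (List.finRange n).take (m + 1) = (List.finRange n).take m ++ [⟨m, hm⟩] := by
        rw [List.take_add_one]
        simp [hm]
      have hfix : ∀ c : V n,
          (((List.finRange n).take m).map fun j => kappa (Fin.rev j) (c.1 j)).prod
            (Fin.rev ⟨m, hm⟩) = Fin.rev ⟨m, hm⟩ := by
        intro c
        apply prod_fix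
        intro j hj
        obtain ⟨k, hk, rfl⟩ := List.mem_take_iff_getElem.mp hj
        have hk' : k < m := by omega
        simp only [List.getElem_finRange, Fin.lt_def, Fin.val_rev, Fin.val_cast]
        omega
      have hpiv : ∀ c : V n, kappa (Fin.rev ⟨m, hm⟩) (c.1 ⟨m, hm⟩)
          ⟨n - c.1 ⟨m, hm⟩, by have := (c.2 ⟨m, hm⟩).1; omega⟩ = Fin.rev ⟨m, hm⟩ := by
        intro c
        have hc := c.2 ⟨m, hm⟩
        simp only at hc
        exact kappa_pivot _ _ hc.1 (by simp only [Fin.val_rev]; omega)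
      rw [key] at h
      simp only [List.map_append, List.prod_append, List.map_cons, List.map_nil,
        List.prod_singleton] at h
      have hlast : a.1 ⟨m, hm⟩ = b.1 ⟨m, hm⟩ := by
        have e1 := congrArg (fun p : Equiv.Perm (Fin n) =>
          p ⟨n - a.1 ⟨m, hm⟩, by have := (a.2 ⟨m, hm⟩).1; omega⟩) h
        simp only [Equiv.Perm.mul_apply] at e1
        rw [hpiv a, hfix a] at e1
        have e2 := congrArg
          (((List.finRange n).take m).map fun j => kappa (Fin.rev j) (b.1 j)).prod (hpiv b)
        rw [hfix b] at e2
        have e3 := (kappa _ _).injective (Equiv.injective _ (e1.symm.trans e2.symm))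
        have e4 := congrArg Fin.val e3
        have ha := a.2 ⟨m, hm⟩
        have hb := b.2 ⟨m, hm⟩
        simp only at e4 ha hb
        omega
      rw [hlast] at h
      have hprev := ih (mul_right_cancel h)
      intro j hj
      by_cases hjm : (j : ℕ) = m
      · have : j = ⟨m, hm⟩ := Fin.ext hjm
        rw [this]; exact hlast
      · exact hprev j (by omega)
    · have e : ∀ k, n ≤ k → (List.finRange n).take k = List.finRange n :=
        fun k hk => List.take_of_length_le (by simpa using hk)
      rw [e (m + 1) (by omega)] at h
      rw [e m (by omega)] at ih
      intro j _
      exact ih h j (by have := j.isLt; omega)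

theorem toPerm_injective (n : ℕ) : Function.Injective (toPerm (n := n)) := by
  intro a b h
  apply Subtype.ext
  funext j
  refine prod_injective a b n ?_ j j.isLt
  rw [List.take_of_length_le (by simp)]
  simpa [toPerm, List.ofFn_eq_map] using h

/-- `V_n` is in bijection with `{0} × {0,1} × ⋯ × {0,…,n-1}`. -/
def vEquiv (n : ℕ) : V n ≃ ((j : Fin n) → Fin ((j : ℕ) + 1)) where
  toFun a j := ⟨a.1 j - 1, by have := a.2 j; omega⟩
  invFun f := ⟨fun j => (f j : ℕ) + 1, fun j => by
    have := (f j).isLt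
    constructor <;> dsimp only <;> omega⟩
  left_inv a := by
    apply Subtype.ext
    funext j
    have := a.2 j
    simp only
    omega
  right_inv f := by
    funext j
    apply Fin.ext
    simp

theorem toPerm_bijective (n : ℕ) : Function.Bijective (toPerm (n := n)) := by
  have : Finite (V n) := Finite.of_equiv _ (vEquiv n).symm
  refine (Nat.bijective_iff_injective_and_card _).mpr ⟨toPerm_injective n, ?_⟩
  rw [Nat.card_congr (vEquiv n), Nat.card_pi, Nat.card_perm]
  simp only [Nat.card_eq_fintype_card, Fintype.card_fin]
  rw [Fin.prod_univ_eq_prod_range (fun i => i + 1) n, Finset.prod_range_add_one_eq_factorial]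

/-- `R(π)`: the unique vector of `V_n` whose image under `toPerm` is `π`. -/
noncomputable def R {n : ℕ} (π : Equiv.Perm (Fin n)) : V n :=
  (Equiv.ofBijective toPerm (toPerm_bijective n)).symm π

/-- The parity of a vector of `V_n`: the sum of its components. -/
def vecParity {n : ℕ} (a : V n) : ℕ := ∑ j : Fin n, a.1 j

/-- The parity of a permutation `π`: the sum of the components of `R(π)`. -/
noncomputable def parity {n : ℕ} (π : Equiv.Perm (Fin n)) : ℕ := vecParity (R π)

/-- `π^{(j)} = κ_{n-j-1,1} ∘ ρ`. -/
noncomputable def descent {n : ℕ} (ρ : Equiv.Perm (Fin n)) (j : Fin n) : Equiv.Perm (Fin n) :=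
  kappa (Fin.rev j) 1 * ρ

end SuffixBlock

namespace SuffixBlock

/-! Encode `π` by the sequence `0, π⁻¹ 0, …, π⁻¹ (n-1)` and weight a descent at index `k` by `n -
k`. Building `π` up by its factors, `κ_{i,s}` adds exactly `n - i - s` to this weighted count
(`wdesc_pos_mul_kappa`), so parity plus weighted count is `1 + ⋯ + n` (`parity_eq`). Left
multiplication by `κ_{i,1}` moves the last entry `P` of the sequence to index `i + 1`
(`pos_kappa_mul`). As `i` grows, each new weighted count is the least or the greatest value still
unused in an interval of length `n` (`image_wdesc_insertAfter`). Hence the counts, and so the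
parities, fill `n` consecutive integers. -/

/-- The indicator, with values in `ℤ`, of a descent from `a` to `b`. -/
def desc (a b : ℕ) : ℤ := if b < a then 1 else 0

/-- The weighted number of descents of the sequence `p 0, p 1, …, p (n+1)`; a descent between
`p k` and `p (k + 1)` has weight `n - k`. -/
def wdesc (n : ℕ) (p : ℕ → ℕ) : ℤ :=
  ∑ k ∈ Finset.range (n + 1), ((n : ℤ) - k) * desc (p k) (p (k + 1))

/-- The positions of the values `0, 1, …, n - 1` in the vector of `π`, preceded by `0`. -/
def pos {n : ℕ} (π : Equiv.Perm (Fin n)) : ℕ → ℕ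
  | 0 => 0
  | k + 1 => if h : k < n then (π⁻¹ ⟨k, h⟩ : Fin n) else 0

theorem pos_succ {n : ℕ} (π : Equiv.Perm (Fin n)) (k : Fin n) :
    pos π (k + 1) = (π⁻¹ k : Fin n) := by
  simp [pos]

/-- Summation by parts; since the weights drop by one at each step, it turns weighted jumps of an
indicator into a plain count. -/
theorem sum_range_mul_sub (N : ℤ) (e : ℕ → ℤ) (m : ℕ) :
    ∑ k ∈ Finset.range m, (N - k) * (e (k + 1) - e k) =
      ∑ k ∈ Finset.range m, e (k + 1) + (N - m) * e m - N * e 0 := by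
  induction m with
  | zero => simp
  | succ m ih =>
    rw [Finset.sum_range_succ, ih, Finset.sum_range_succ]
    push_cast
    ring

theorem sum_lt_apply_eq {n : ℕ} (σ : Equiv.Perm (Fin n)) (r : ℕ) (hr : r < n) :
    ∑ k : Fin n, (if r < (σ k : ℕ) then (1 : ℤ) else 0) = n - 1 - r := by
  rw [Equiv.sum_comp σ (fun x : Fin n => if r < (x : ℕ) then (1 : ℤ) else 0),
    Fin.sum_univ_eq_sum_range (fun x : ℕ => if r < x then (1 : ℤ) else 0), Finset.sum_boole]
  have : (Finset.range n).filter (fun x => r < x) = Finset.Ico (r + 1) n := by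
    ext x
    simp only [Finset.mem_filter, Finset.mem_range, Finset.mem_Ico]
    omega
  rw [this, Nat.card_Ico]
  omega

/-! ### Effect of one factor `κ_{i,s}` on the weighted descents -/

section Peel

variable {n : ℕ} (σ : Equiv.Perm (Fin n)) (i : Fin n) (s : ℕ)

theorem kappa_inv_mul_apply (k : Fin n) :
    (σ⁻¹ k : Fin n) = kappa i s ((σ * kappa i s)⁻¹ k) := by
  simp

theorem inv_mul_kappa_of_lt (hσ : ∀ x ≤ i, σ x = x) (k : Fin n) (hk : k < i) :
    (σ * kappa i s)⁻¹ k = k := by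
  rw [Equiv.Perm.inv_eq_iff_eq, Equiv.Perm.mul_apply, kappa_of_lt i s k hk, hσ k hk.le]

theorem inv_mul_kappa_self (hσ : ∀ x ≤ i, σ x = x) (h1 : 1 ≤ s) (h2 : s ≤ n - i) :
    (((σ * kappa i s)⁻¹ i : Fin n) : ℕ) = n - s := by
  have : (σ * kappa i s)⁻¹ i = ⟨n - s, by have := i.isLt; omega⟩ := by
    rw [Equiv.Perm.inv_eq_iff_eq, Equiv.Perm.mul_apply, kappa_pivot i s h1 h2, hσ i le_rfl]
  rw [this]

theorem inv_mul_kappa_of_gt (hσ : ∀ x ≤ i, σ x = x) (h1 : 1 ≤ s) (h2 : s ≤ n - i) (k : Fin n)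
    (hk : i < k) :
    (i : ℕ) ≤ ((σ * kappa i s)⁻¹ k : Fin n) ∧ (((σ * kappa i s)⁻¹ k : Fin n) : ℕ) ≠ n - s := by
  constructor
  · by_contra h
    have hlt : (σ * kappa i s)⁻¹ k < i := not_le.mp h
    have h3 := inv_mul_kappa_of_lt σ i s hσ _ hlt
    have h4 := (σ * kappa i s)⁻¹.injective h3
    rw [h4] at hlt
    exact absurd hk hlt.asymm
  · rw [← inv_mul_kappa_self σ i s hσ h1 h2]
    intro h
    have := (σ * kappa i s)⁻¹.injective (Fin.ext h)
    exact hk.ne' this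

/-- The positions `≥ i` are rotated cyclically, so a comparison changes only between entries on
opposite sides of the cut `r = n - s`. These changes are jumps of the indicator `e` of lying above
the cut; summed by parts they count the `s - 1` positions above it. -/
theorem wdesc_pos_mul_kappa (hσ : ∀ x ≤ i, σ x = x) (h1 : 1 ≤ s) (h2 : s ≤ n - i) :
    wdesc n (pos (σ * kappa i s)) = wdesc n (pos σ) + (n - i - s) := by
  have hi := i.isLt
  set p := pos (σ * kappa i s) with hp
  set r := n - s with hr
  set e : ℕ → ℤ := fun k => if r < p k then 1 else 0 with he
  have p0 : p 0 = 0 := rfl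
  have p0' : pos σ 0 = 0 := rfl
  have plt : ∀ k < (i : ℕ), p (k + 1) = k ∧ pos σ (k + 1) = k := by
    intro k hk
    have a := inv_mul_kappa_of_lt σ i s hσ ⟨k, by omega⟩ hk
    have b := kappa_inv_mul_apply σ i s ⟨k, by omega⟩
    rw [a, kappa_of_lt _ _ _ hk] at b
    have c := pos_succ (σ * kappa i s) ⟨k, by omega⟩
    have d := pos_succ σ ⟨k, by omega⟩
    rw [a] at c
    rw [b] at d
    exact ⟨c, d⟩
  have pi : p (i + 1) = r ∧ pos σ (i + 1) = i := by
    have a := inv_mul_kappa_self σ i s hσ h1 h2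
    have b : σ⁻¹ i = i := by rw [Equiv.Perm.inv_eq_iff_eq, hσ i le_rfl]
    refine ⟨by rw [hp, pos_succ, a], by rw [pos_succ, b]⟩
  have pgt : ∀ k, (i : ℕ) < k → k < n → (i : ℕ) ≤ p (k + 1) ∧ p (k + 1) ≠ r ∧ p (k + 1) < n ∧
      (p (k + 1) < r → pos σ (k + 1) = p (k + 1) + s) ∧
      (r < p (k + 1) → pos σ (k + 1) + r = i + p (k + 1)) := by
    intro k hk hkn
    obtain ⟨a1, a2⟩ := inv_mul_kappa_of_gt σ i s hσ h1 h2 ⟨k, hkn⟩ hk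
    have b := kappa_inv_mul_apply σ i s ⟨k, hkn⟩
    have c := pos_succ (σ * kappa i s) ⟨k, hkn⟩
    have d := pos_succ σ ⟨k, hkn⟩
    simp only at c d
    rw [← hp] at c
    rw [b] at d
    rw [c, d]
    refine ⟨a1, a2, Fin.isLt _, fun h => ?_, fun h => ?_⟩
    · rw [kappa_of_left _ _ _ a1 (by omega)]
    · rw [kappa_of_right _ _ _ h2 (by omega)]
      omega
  -- The exception is `k = i + 1`: there `p k = r` moves to `i`, below all later entries, so a
  -- descent into an entry below the cut disappears although `e` does not jump.
  have key : ∀ k < n, desc (pos σ k) (pos σ (k + 1)) =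
      desc (p k) (p (k + 1)) + (e (k + 1) - e k) - if k = i + 1 then 1 else 0 := by
    intro k hk
    simp only [he, desc]
    rcases lt_trichotomy k (i + 1) with h | h | h
    · rcases k with _ | k
      · rcases Nat.eq_zero_or_pos (i : ℕ) with h0 | h0
        · rw [h0] at pi
          simp only [zero_add] at pi ⊢
          rw [p0, p0', pi.1, pi.2]
          simp
        · have := plt 0 h0
          simp only [zero_add] at this ⊢
          rw [p0, p0', this.1, this.2]
          simp
      · have a := plt k (by omega)
        rcases Nat.lt_or_ge (k + 1) i with h' | h'
        · have b := plt (k + 1) h'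
          rw [a.1, a.2, b.1, b.2]
          split_ifs <;> omega
        · have hk1 : k + 1 = i := by omega
          rw [hk1] at a ⊢
          rw [a.1, a.2, pi.1, pi.2]
          split_ifs <;> omega
    · have b := pgt (i + 1) (by omega) (by omega)
      rw [h, pi.1, pi.2]
      split_ifs <;> omega
    · obtain ⟨k, rfl⟩ : ∃ m, k = m + 1 := ⟨k - 1, by omega⟩
      have a := pgt k (by omega) (by omega)
      have b := pgt (k + 1) (by omega) (by omega)
      split_ifs <;> omega
  have cnt : ∑ k ∈ Finset.range n, e (k + 1) = n - 1 - r := by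
    rw [← sum_lt_apply_eq (σ * kappa i s)⁻¹ r (by omega),
      ← Fin.sum_univ_eq_sum_range (fun k => e (k + 1))]
    exact Finset.sum_congr rfl fun k _ => by simp only [he, hp, pos_succ]
  have abel := sum_range_mul_sub n e n
  have e0 : e 0 = 0 := by simp [he, p0]
  rw [cnt, e0] at abel
  have single : ∑ k ∈ Finset.range n, ((n : ℤ) - k) * (if k = i + 1 then 1 else 0) =
      n - i - 1 := by
    simp only [mul_ite, mul_one, mul_zero, Finset.sum_ite_eq', Finset.mem_range]
    split_ifs
    · push_cast; ring
    · omega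
  have main : wdesc n (pos σ) = wdesc n p + (n - 1 - r) - (n - i - 1) := by
    unfold wdesc
    rw [Finset.sum_range_succ, Finset.sum_range_succ, sub_self, zero_mul, zero_mul, add_zero,
      add_zero, ← single]
    have abel' : ∑ k ∈ Finset.range n, ((n : ℤ) - k) * (e (k + 1) - e k) = n - 1 - r := by
      rw [abel]; ring
    rw [← abel', ← Finset.sum_add_distrib, ← Finset.sum_sub_distrib]
    refine Finset.sum_congr rfl fun k hk => ?_
    rw [key k (Finset.mem_range.mp hk)]
    ring
  rw [main]
  omega

end Peel

/-! ### Parity as a complementary descent statistic -/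

theorem wdesc_pos_one (n : ℕ) : wdesc n (pos (1 : Equiv.Perm (Fin n))) = 0 := by
  unfold wdesc
  refine Finset.sum_eq_zero fun k hk => ?_
  rcases Nat.lt_or_ge k n with h | h
  · have : desc (pos (1 : Equiv.Perm (Fin n)) k) (pos (1 : Equiv.Perm (Fin n)) (k + 1)) = 0 := by
      rcases k with _ | k
      · simp [desc, pos]
      · simp [desc, pos, h, show k < n by omega]
    rw [this, mul_zero]
  · have : k = n := by have := Finset.mem_range.mp hk; omega
    rw [this, sub_self, zero_mul]

/-- The factor of index `m` has `i = n - 1 - m`, so it contributes `m + 1 - a_m` to the weighted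
count and `a_m` to the sum. -/
theorem wdesc_pos_prod {n : ℕ} (a : V n) (m : ℕ) (hm : m ≤ n) :
    wdesc n (pos (((List.finRange n).take m).map fun j => kappa (Fin.rev j) (a.1 j)).prod) +
      (((List.finRange n).take m).map fun j => (a.1 j : ℤ)).sum =
    ∑ k ∈ Finset.range m, ((k : ℤ) + 1) := by
  induction m with
  | zero => simp [wdesc_pos_one]
  | succ m ih =>
    have hm' : m < n := hm
    have key : (List.finRange n).take (m + 1) = (List.finRange n).take m ++ [⟨m, hm'⟩] := by
      rw [List.take_add_one]
      simp [hm']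
    have hfix : ∀ x ≤ Fin.rev (⟨m, hm'⟩ : Fin n),
        (((List.finRange n).take m).map fun j => kappa (Fin.rev j) (a.1 j)).prod x = x := by
      intro x hx
      apply prod_fix
      intro j hj
      obtain ⟨k, hk, rfl⟩ := List.mem_take_iff_getElem.mp hj
      have hk' : k < m := by omega
      simp only [List.getElem_finRange, Fin.lt_def, Fin.le_def, Fin.val_rev, Fin.val_cast] at hx ⊢
      omega
    have ha := a.2 ⟨m, hm'⟩
    simp only at ha
    rw [key, Finset.sum_range_succ, ← ih (by omega)]
    simp only [List.map_append, List.prod_append, List.map_cons, List.map_nil,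
      List.prod_singleton, List.sum_append, List.sum_singleton]
    rw [wdesc_pos_mul_kappa _ _ _ hfix ha.1 (by simp only [Fin.val_rev]; omega)]
    simp only [Fin.val_rev]
    push_cast [show m + 1 ≤ n from hm]
    ring

/-- The parity is complementary to the weighted number of descents of the positions. -/
theorem parity_eq {n : ℕ} (π : Equiv.Perm (Fin n)) :
    (parity π : ℤ) = ∑ k ∈ Finset.range n, ((k : ℤ) + 1) - wdesc n (pos π) := by
  have hπ : toPerm (R π) = π :=
    (Equiv.ofBijective toPerm (toPerm_bijective n)).apply_symm_apply π
  have h := wdesc_pos_prod (R π) n le_rfl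
  rw [List.take_of_length_le (by simp), ← List.ofFn_eq_map, ← List.ofFn_eq_map, List.sum_ofFn]
    at h
  change wdesc n (pos (toPerm (R π))) + _ = _ at h
  rw [hπ] at h
  rw [← h, parity, vecParity]
  push_cast
  ring

/-! ### Moving the last entry of the position sequence -/

/-- The sequence `q` with `P` inserted as the entry of index `i + 1`. -/
def insertAfter (q : ℕ → ℕ) (P i k : ℕ) : ℕ :=
  if k ≤ i then q k else if k = i + 1 then P else q (k - 1)

/-- Relative to the weights `n - 1 - k`, descents before the insertion gain one, while later ones
are shifted by one index and keep their weight. Only the replaced pair at `i` needs separate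
treatment; the induction on `m` extends the unaffected tail. -/
theorem wdesc_insertAfter_aux (n : ℤ) (q : ℕ → ℕ) (P i m : ℕ) :
    ∑ k ∈ Finset.range (i + 2 + m),
      (n - k) * desc (insertAfter q P i k) (insertAfter q P i (k + 1)) =
    ∑ k ∈ Finset.range (i + 1 + m), (n - 1 - k) * desc (q k) (q (k + 1)) +
      (∑ k ∈ Finset.range i, desc (q k) (q (k + 1)) + desc (q i) P) +
      (desc (q i) P + desc P (q (i + 1)) - desc (q i) (q (i + 1))) * (n - 1 - i) := by
  induction m with
  | zero =>
    have h : ∀ k ∈ Finset.range i,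
        (n - k) * desc (insertAfter q P i k) (insertAfter q P i (k + 1)) =
        (n - 1 - k) * desc (q k) (q (k + 1)) + desc (q k) (q (k + 1)) := by
      intro k hk
      have hk := Finset.mem_range.mp hk
      simp only [insertAfter, show k ≤ i by omega, show k + 1 ≤ i by omega, if_true]
      ring
    simp only [add_zero]
    rw [Finset.sum_range_succ, Finset.sum_range_succ, Finset.sum_range_succ,
      Finset.sum_congr rfl h, Finset.sum_add_distrib]
    have e1 : insertAfter q P i i = q i := by simp [insertAfter]
    have e2 : insertAfter q P i (i + 1) = P := by simp [insertAfter]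
    have e3 : insertAfter q P i (i + 1 + 1) = q (i + 1) := by simp [insertAfter]
    rw [e1, e2, e3]
    push_cast
    ring
  | succ m ih =>
    rw [← add_assoc (i + 2), ← add_assoc (i + 1), Finset.sum_range_succ,
      Finset.sum_range_succ _ (i + 1 + m), ih]
    have e1 : insertAfter q P i (i + 2 + m) = q (i + 1 + m) := by
      rw [insertAfter, if_neg (by omega), if_neg (by omega)]
      congr 1; omega
    have e2 : insertAfter q P i (i + 2 + m + 1) = q (i + 1 + m + 1) := by
      rw [insertAfter, if_neg (by omega), if_neg (by omega)]
      congr 1; omega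
    rw [e1, e2]
    push_cast
    ring

theorem wdesc_insertAfter (n : ℕ) (q : ℕ → ℕ) (P i : ℕ) (hi : i < n) :
    wdesc n (insertAfter q P i) =
    ∑ k ∈ Finset.range n, ((n : ℤ) - 1 - k) * desc (q k) (q (k + 1)) +
      (∑ k ∈ Finset.range i, desc (q k) (q (k + 1)) + desc (q i) P) +
      (desc (q i) P + desc P (q (i + 1)) - desc (q i) (q (i + 1))) * (n - 1 - i) := by
  have h := wdesc_insertAfter_aux n q P i (n - 1 - i)
  rw [show i + 2 + (n - 1 - i) = n + 1 by omega, show i + 1 + (n - 1 - i) = n by omega] at h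
  exact h

theorem wdesc_congr {n : ℕ} {p q : ℕ → ℕ} (h : ∀ k ≤ n, p k = q k) :
    wdesc n p = wdesc n q := by
  unfold wdesc
  rw [Finset.sum_range_succ, Finset.sum_range_succ, sub_self, zero_mul, zero_mul]
  congr 1
  refine Finset.sum_congr rfl fun k hk => ?_
  have := Finset.mem_range.mp hk
  rw [h k (by omega), h (k + 1) (by omega)]

theorem pos_kappa_mul {n : ℕ} (i : Fin n) (ρ : Equiv.Perm (Fin n)) (k : ℕ) (hk : k ≤ n) :
    pos (kappa i 1 * ρ) k = insertAfter (pos ρ) (pos ρ n) i k := by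
  have hi := i.isLt
  rcases k with _ | k
  · simp [pos, insertAfter]
  · have main : ∀ x : Fin n, (kappa i 1 x : ℕ) = k →
        pos (kappa i 1 * ρ) (k + 1) = pos ρ (x + 1) := by
      intro x hx
      have hx' : kappa i 1 x = ⟨k, hk⟩ := Fin.ext hx
      have h := pos_succ (kappa i 1 * ρ) ⟨k, hk⟩
      simp only at h
      simp [h, pos_succ, ← hx']
    rcases lt_trichotomy k i with h | h | h
    · rw [main ⟨k, hk⟩ (by rw [kappa_of_lt _ _ _ h]), insertAfter, if_pos (by omega)]
    · rw [main ⟨n - 1, by omega⟩, insertAfter, if_neg (by omega), if_pos (by omega)]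
      · congr 1
        simp only
        omega
      · rw [kappa_of_right _ _ _ (by omega) (by simp only; omega)]
        simp only
        omega
    · rw [main ⟨k - 1, by omega⟩, insertAfter, if_neg (by omega), if_neg (by omega)]
      · congr 1
        simp only
        omega
      · rw [kappa_of_left _ _ _ (by simp only [Fin.le_def]; omega) (by simp only; omega)]
        simp only
        omega

/-- If each `F i` is either the least or the greatest element of the interval left over by
`F 0, …, F (i - 1)`, then `F` exhausts the interval. -/
theorem image_eq_Ico_of_extremal (n : ℕ) (F c : ℕ → ℤ)
    (h : ∀ i < n, (F i = c i ∧ c (i + 1) = c i + 1) ∨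
      (F i = c i + (n - 1 - i) ∧ c (i + 1) = c i)) :
    (Finset.range n).image F = Finset.Ico (c 0) (c 0 + n) := by
  induction n generalizing F c with
  | zero => simp
  | succ n ih =>
    have h' := ih (fun i => F (i + 1)) (fun i => c (i + 1)) (by
      intro i hi
      have := h (i + 1) (by omega)
      push_cast at this
      rcases this with h1 | h1
      · exact Or.inl h1
      · exact Or.inr ⟨by rw [h1.1]; ring, h1.2⟩)
    have h0 := h 0 (by omega)
    ext x
    have hx := Finset.ext_iff.mp h' x
    simp only [Finset.mem_image, Finset.mem_range, Finset.mem_Ico, zero_add] at hx h0 ⊢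
    have split : (∃ a < n + 1, F a = x) ↔ (F 0 = x ∨ ∃ a < n, F (a + 1) = x) := by
      constructor
      · rintro ⟨_ | a, ha, hax⟩
        · exact Or.inl hax
        · exact Or.inr ⟨a, by omega, hax⟩
      · rintro (h | ⟨a, ha, hax⟩)
        · exact ⟨0, by omega, h⟩
        · exact ⟨a + 1, by omega, hax⟩
    rw [split, hx]
    push_cast at h0 ⊢
    omega

theorem desc_add_desc_of_ne {a b : ℕ} (h : a ≠ b) : desc a b + desc b a = 1 := by
  unfold desc
  split_ifs <;> omega

/-- If `b < a`, then `P` cannot be at least `a` and at most `b`; two descents in a row force `b <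
a`. -/
theorem desc_cycle (a P b : ℕ) :
    desc a P + desc P b - desc a b = 0 ∨ desc a P + desc P b - desc a b = 1 := by
  unfold desc
  split_ifs <;> omega

theorem image_wdesc_insertAfter (n : ℕ) (q : ℕ → ℕ)
    (hq : ∀ i, i + 1 < n → q (i + 1) ≠ q n) :
    ∃ W : ℤ, (Finset.range n).image (fun i => wdesc n (insertAfter q (q n) i)) =
      Finset.Ico W (W + n) := by
  set W := ∑ k ∈ Finset.range n, ((n : ℤ) - 1 - k) * desc (q k) (q (k + 1)) with hW
  set out : ℕ → ℤ := fun i => desc (q i) (q n) + desc (q n) (q (i + 1)) -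
    desc (q i) (q (i + 1)) with hout
  set c : ℕ → ℤ := fun i => W + (∑ k ∈ Finset.range i, desc (q k) (q (k + 1)) + desc (q i) (q n))
    with hc
  -- This is `c 0`, the lower end of the interval before any value is used.
  refine ⟨W + ∑ k ∈ Finset.range 0, desc (q k) (q (k + 1)) + desc (q 0) (q n), ?_⟩
  have := image_eq_Ico_of_extremal n (fun i => wdesc n (insertAfter q (q n) i))
    -- At index `n` the formula for `c` would compare `q n` with itself, so the end value is set by
    -- hand; for `i = n - 1` the least and greatest remaining values coincide.
    (fun i => if i < n then c i else c (n - 1) + 1) (by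
      intro i hi
      have hF : wdesc n (insertAfter q (q n) i) = c i + out i * (n - 1 - i) := by
        rw [wdesc_insertAfter n q (q n) i hi]
      simp only [if_pos hi, hF]
      by_cases hi' : i + 1 < n
      · have hstep : c (i + 1) = c i + 1 - out i := by
          have := desc_add_desc_of_ne (hq i hi')
          simp only [hc, hout, Finset.sum_range_succ]
          linarith
        rw [if_pos hi', hstep]
        rcases desc_cycle (q i) (q n) (q (i + 1)) with h | h
        · left
          have h : out i = 0 := h
          rw [h]
          constructor <;> ring
        · right
          have h : out i = 1 := h
          rw [h]
          constructor <;> ring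
      · left
        have : (n : ℤ) - 1 - i = 0 := by omega
        rw [this, if_neg hi', show n - 1 = i by omega]
        constructor <;> ring)
  rw [this]
  rcases Nat.eq_zero_or_pos n with h | h
  · subst h; simp
  · simp only [if_pos h, hc, add_assoc]

/-- The parities of the permutations `κ_{i,1} ∘ ρ` fill an interval of length `n`. -/
theorem exists_image_parity_eq_Ico {n : ℕ} (ρ : Equiv.Perm (Fin n)) :
    ∃ c : ℤ, Finset.univ.image (fun j : Fin n => (parity (descent ρ j) : ℤ)) =
      Finset.Ico c (c + n) := by
  obtain ⟨W, hW⟩ := image_wdesc_insertAfter n (pos ρ) (by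
    intro i hi h
    have h1 := pos_succ ρ ⟨i, by omega⟩
    have h2 := pos_succ ρ ⟨n - 1, by omega⟩
    simp only [show n - 1 + 1 = n by omega] at h1 h2
    have h3 := ρ⁻¹.injective (Fin.ext (h1.symm.trans (h.trans h2)))
    have := congrArg Fin.val h3
    simp only at this
    omega)
  set N : ℤ := ∑ k ∈ Finset.range n, ((k : ℤ) + 1)
  have hval : ∀ j : Fin n, (parity (descent ρ j) : ℤ) =
      N - wdesc n (insertAfter (pos ρ) (pos ρ n) (Fin.rev j : Fin n)) := fun j => by
    rw [parity_eq, descent, wdesc_congr (pos_kappa_mul (Fin.rev j) ρ)]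
  -- The reflection `x ↦ N - x` sends the greatest count `W + n - 1` to the least parity.
  refine ⟨N - W - n + 1, ?_⟩
  ext x
  have hx := Finset.ext_iff.mp hW (N - x)
  simp only [Finset.mem_image, Finset.mem_range, Finset.mem_univ, true_and, Finset.mem_Ico]
    at hx ⊢
  have : (∃ j : Fin n, (parity (descent ρ j) : ℤ) = x) ↔
      ∃ i < n, wdesc n (insertAfter (pos ρ) (pos ρ n) i) = N - x := by
    constructor
    · rintro ⟨j, hj⟩
      exact ⟨(Fin.rev j : Fin n), Fin.isLt _, by rw [← hj, hval]; ring⟩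
    · rintro ⟨i, hi, h⟩
      exact ⟨Fin.rev ⟨i, hi⟩, by rw [hval, Fin.rev_rev]; simp only [h]; ring⟩
  rw [this, hx]
  constructor <;> intro h <;> constructor <;> linarith [h.1, h.2]

end SuffixBlock

/-! ### Distinctness and residues from the interval -/

theorem mainTheorem3 (n : ℕ) (hn : 0 < n) (ρ : Equiv.Perm (Fin n)) :
    Function.Injective (fun j : Fin n => SuffixBlock.parity (SuffixBlock.descent ρ j)) ∧
    (∃ c : ℕ, Set.range (fun j : Fin n => SuffixBlock.parity (SuffixBlock.descent ρ j)) =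
      Set.Ico c (c + n)) ∧
    (∀ T : ℤ, ∃! j : Fin n,
      (SuffixBlock.parity (SuffixBlock.descent ρ j) : ℤ) ≡ T [ZMOD (n : ℤ)]) := by
  obtain ⟨c, hc⟩ := SuffixBlock.exists_image_parity_eq_Ico ρ
  have hinj : Function.Injective
      (fun j : Fin n => (SuffixBlock.parity (SuffixBlock.descent ρ j) : ℤ)) := by
    -- The image has `n` elements, as many as the domain.
    rw [← Set.injOn_univ, ← Finset.coe_univ, ← Finset.card_image_iff, hc]
    simp
  have hmem : ∀ x : ℤ, (∃ j : Fin n, (SuffixBlock.parity (SuffixBlock.descent ρ j) : ℤ) = x) ↔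
      c ≤ x ∧ x < c + n := fun x => by
    simpa using Finset.ext_iff.mp hc x
  have hc0 : 0 ≤ c := by
    obtain ⟨j, hj⟩ := (hmem c).mpr ⟨le_rfl, by omega⟩
    omega
  refine ⟨fun i j h => hinj (congrArg Nat.cast h), ⟨c.toNat, ?_⟩, fun T => ?_⟩
  · ext x
    have := hmem x
    simp only [Nat.cast_inj] at this
    rw [Set.mem_range, this, Set.mem_Ico]
    omega
  · have hn' : (0 : ℤ) < n := by exact_mod_cast hn
    -- The representative of `T` modulo `n` in `[c, c + n)`.
    obtain ⟨j, hj⟩ := (hmem (c + (T - c) % n)).mpr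
      ⟨by have := Int.emod_nonneg (T - c) hn'.ne'; omega,
        by have := Int.emod_lt_of_pos (T - c) hn'; omega⟩
    have hjT : (SuffixBlock.parity (SuffixBlock.descent ρ j) : ℤ) ≡ T [ZMOD (n : ℤ)] := by
      rw [hj]
      simpa using (Int.ModEq.refl c).add (Int.mod_modEq (T - c) n)
    refine ⟨j, hjT, fun k hk => hinj ?_⟩
    have hd := (hk.trans hjT.symm).dvd
    have h1 := (hmem _).mp ⟨k, rfl⟩
    have h2 := (hmem _).mp ⟨j, rfl⟩
    have := Int.eq_zero_of_abs_lt_dvd hd 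
      (by rw [abs_lt]; constructor <;> linarith [h1.1, h1.2, h2.1, h2.2])
    simp only
    omega
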